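/- Let $n\ge 3$ and let $Q_{2n}$ be the real nilpotent Lie algebra with basis $X_1,\dots,X_{2n}$ and brackets $$[X_1,X_i]=X_{i+1}\quad(2\le i\le 2n-2),\qquad [X_k,X_{2n+1-k}]=(-1)^kX_{2n}\quad(2\le k\le n),$$ all other brackets of basis vectors not determined by antisymmetry being zero. Write $[X_i,X_j]=\sum_k C_{ij}^kX_k$, let $x_1,\dots,x_{2n}$ be the corresponding coordinates on $Q_{2n}^*\cong\mathbb R^{2n}$, and call a smooth function $F$ on an open set $U\subseteq\mathbb R^{2n}$ an invariant on $U$ if $$\widehat X_iF:=-\sum_{j,k}C_{ij}^k\,x_k\,\frac{\partial F}{\partial x_j}=0\quad\text{on }U\text{ for all }1\le i\le 2n .$$ Finitely many functions are called functionally independent on $U$ if their differentials are linearly independent at every point of some dense subset of $U$. A fundamental set of invariants on $U$ is a functionally independent family of invariants on $U$ that cannot be enlarged by a further invariant to a functionally independent family. Put $$I_1=x_{2n},\qquad I_2=x_1x_{2n}+x_3x_{2n-1}+\sum_{k=4}^{n}(-1)^{k+1}x_kx_{2n+2-k}+\frac{(-1)^n}{2}x_{n+1}^2 .$$ Then $Q_{2n}$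 has exactly two independent Casimir operators, given by the symmetrizations of $I_1$ and $I_2$. That is: 1. For every nonempty open $U\subseteq\mathbb R^{2n}$, the largest number of functionally independent invariants on $U$ is $2$, and $I_1,I_2$ form a fundamental set of invariants on $U$. 2. The largest number of functionally independent polynomial invariants on $\mathbb R^{2n}$ is $2$. 3. The images of $I_1$ and $I_2$ under the symmetrization map (the linear map from $\mathbb R[x_1,\dots,x_{2n}]$ to the universal enveloping algebra of $Q_{2n}$ with $x_{i_1}\cdots x_{i_r}\mapsto\frac1{r!}\sum_{\sigma\in S_r}X_{i_{\sigma(1)}}\cdots X_{i_{\sigma(r)}}$) lie in the centre of the universal enveloping algebra, and they are obtained by replacing each $x_i$ by $X_i$, that is, they equal $X_{2n}$ and $X_1X_{2n}+X_3X_{2n-1}+\sum_{k=4}^{n}(-1)^{k+1}X_kX_{2n+2-k}+\frac{(-1)^n}{2}X_{n+1}^2$. -/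

import Mathlib

open scoped ContDiff

/-- The `k`-th entry, counted from `1`, of a tuple of length `m` (and `0` outside `1 ≤ k ≤ m`). -/
def oneBased {M : Type*} [Zero M] {m : ℕ} (v : Fin m → M) (k : ℕ) : M :=
  if h : 1 ≤ k ∧ k ≤ m then v ⟨k - 1, by omega⟩ else 0

/-! ### The Lie algebra `Q_{2n}` -/

/-- The real vector space underlying `Q_{2n}`, of dimension `2n`. -/
def QAlg (n : ℕ) : Type := Fin (2 * n) → ℝ

namespace QAlg

noncomputable section

instance (n : ℕ) : AddCommGroup (QAlg n) := inferInstanceAs (AddCommGroup (Fin (2 * n) → ℝ))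

instance (n : ℕ) : Module ℝ (QAlg n) := inferInstanceAs (Module ℝ (Fin (2 * n) → ℝ))

/-- The basis `(X_1, …, X_{2n})` of `Q_{2n}`, indexed by `Fin (2 * n)`. -/
def basis (n : ℕ) : Module.Basis (Fin (2 * n)) ℝ (QAlg n) := Pi.basisFun ℝ (Fin (2 * n))

/-- The basis vector `X_k`, with `1 ≤ k ≤ 2n`. -/
def gen (n k : ℕ) : QAlg n := oneBased (basis n) k

/-- The `k`-th coordinate, `1 ≤ k ≤ 2n`, with respect to the basis `(X_1, …, X_{2n})`. -/
def coord {n : ℕ} (x : QAlg n) (k : ℕ) : ℝ := oneBased (m := 2 * n) x k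

/-- The bracket is the alternating bilinear map with
`[X_1, X_i] = X_{i+1}` for `2 ≤ i ≤ 2n-2`, `[X_k, X_{2n+1-k}] = (-1)^k X_{2n}` for `2 ≤ k ≤ n`, and
all brackets of basis vectors that do not follow from these by antisymmetry equal to zero. -/
instance (n : ℕ) : Bracket (QAlg n) (QAlg n) where
  bracket x y :=
    (∑ i ∈ Finset.Icc 2 (2 * n - 2),
      (coord x 1 * coord y i - coord x i * coord y 1) • gen n (i + 1)) +
    ∑ k ∈ Finset.Icc 2 n,
      ((-1 : ℝ) ^ k * (coord x k * coord y (2 * n + 1 - k) - coord x (2 * n + 1 - k) * coord y k)) •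
        gen n (2 * n)

theorem bracket_def {n : ℕ} (x y : QAlg n) : ⁅x, y⁆ =
    (∑ i ∈ Finset.Icc 2 (2 * n - 2),
      (coord x 1 * coord y i - coord x i * coord y 1) • gen n (i + 1)) +
    ∑ k ∈ Finset.Icc 2 n,
      ((-1 : ℝ) ^ k * (coord x k * coord y (2 * n + 1 - k) - coord x (2 * n + 1 - k) * coord y k)) •
        gen n (2 * n) := rfl

theorem coord_add {n : ℕ} (x y : QAlg n) (k : ℕ) : coord (x + y) k = coord x k + coord y k := by
  unfold coord oneBased
  split_ifs
  · rfl
  · simp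

theorem coord_smul {n : ℕ} (c : ℝ) (x : QAlg n) (k : ℕ) : coord (c • x) k = c * coord x k := by
  unfold coord oneBased
  split_ifs
  · rfl
  · simp

theorem coord_zero {n : ℕ} (k : ℕ) : coord (0 : QAlg n) k = 0 := by
  unfold coord oneBased
  split_ifs <;> rfl

theorem coord_sum {n : ℕ} {ι : Type*} (s : Finset ι) (f : ι → QAlg n) (k : ℕ) :
    coord (∑ i ∈ s, f i) k = ∑ i ∈ s, coord (f i) k := by
  classical
  induction s using Finset.induction_on with
  | empty => simp [coord_zero]
  | insert a s ha ih => rw [Finset.sum_insert ha, Finset.sum_insert ha, coord_add, ih]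

theorem coord_gen {n : ℕ} (i k : ℕ) :
    coord (gen n i) k = if i = k ∧ 1 ≤ k ∧ k ≤ 2 * n then 1 else 0 := by
  by_cases hi : 1 ≤ i ∧ i ≤ 2 * n
  · by_cases hk : 1 ≤ k ∧ k ≤ 2 * n
    · have h : coord (gen n i) k =
          (Pi.single (⟨i - 1, by omega⟩ : Fin (2 * n)) (1 : ℝ) : Fin (2 * n) → ℝ)
            ⟨k - 1, by omega⟩ := by
        simp only [coord, gen, oneBased, basis, hi, hk, and_self, dite_true]
        rw [← Pi.basisFun_apply]
        rfl
      rw [h, Pi.single_apply]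
      have : (⟨k - 1, by omega⟩ : Fin (2 * n)) = ⟨i - 1, by omega⟩ ↔
          i = k ∧ 1 ≤ k ∧ k ≤ 2 * n := by
        rw [Fin.mk.injEq]; omega
      simp only [this]
    · rw [if_neg (by tauto)]
      simp [coord, oneBased, hk]
  · have h0 : gen n i = 0 := by simp [gen, oneBased, hi]
    rw [h0, coord_zero, if_neg]
    rintro ⟨rfl, h⟩
    exact hi h

theorem ext_coord {n : ℕ} {x y : QAlg n} (h : ∀ k, 1 ≤ k → k ≤ 2 * n → coord x k = coord y k) :
    x = y := by
  funext i
  have := h (i + 1) (by omega) (by omega)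
  have hi : (i : ℕ) + 1 ≤ 2 * n := by omega
  simpa [coord, oneBased, hi] using this

/-- The coefficient of `X_{2n}` in the bracket, as one sum over all indices. -/
theorem sum_fold {n : ℕ} (x y : QAlg n) :
    ∑ k ∈ Finset.Icc 2 n,
      (-1 : ℝ) ^ k * (coord x k * coord y (2 * n + 1 - k) - coord x (2 * n + 1 - k) * coord y k) =
    ∑ k ∈ Finset.Icc 2 (2 * n - 1), (-1 : ℝ) ^ k * (coord x k * coord y (2 * n + 1 - k)) := by
  rcases Nat.lt_or_ge n 2 with hn | hn
  · rw [Finset.Icc_eq_empty (by omega), Finset.Icc_eq_empty (by omega)]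
    simp
  have hu : Finset.Icc 2 (2 * n - 1) = Finset.Icc 2 n ∪ Finset.Icc (n + 1) (2 * n - 1) := by
    ext k; simp only [Finset.mem_union, Finset.mem_Icc]; omega
  have hd : Disjoint (Finset.Icc 2 n) (Finset.Icc (n + 1) (2 * n - 1)) := by
    rw [Finset.disjoint_left]; intro k; simp only [Finset.mem_Icc]; omega
  have hs : ∑ k ∈ Finset.Icc (n + 1) (2 * n - 1),
        (-1 : ℝ) ^ k * (coord x k * coord y (2 * n + 1 - k)) =
      ∑ k ∈ Finset.Icc 2 n, -((-1 : ℝ) ^ k * (coord x (2 * n + 1 - k) * coord y k)) := by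
    refine Finset.sum_nbij' (fun k => 2 * n + 1 - k) (fun k => 2 * n + 1 - k) ?_ ?_ ?_ ?_ ?_
    · intro k hk; simp only [Finset.mem_Icc] at hk ⊢; omega
    · intro k hk; simp only [Finset.mem_Icc] at hk ⊢; omega
    · intro k hk; simp only [Finset.mem_Icc] at hk ⊢; omega
    · intro k hk; simp only [Finset.mem_Icc] at hk ⊢; omega
    · intro k hk
      simp only [Finset.mem_Icc] at hk
      have e : 2 * n + 1 - (2 * n + 1 - k) = k := by omega
      have p : (-1 : ℝ) ^ k = -(-1 : ℝ) ^ (2 * n + 1 - k) := by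
        have h1 : (-1 : ℝ) ^ (2 * n + 1 - k) * (-1 : ℝ) ^ k = -1 := by
          rw [← pow_add, show 2 * n + 1 - k + k = 2 * n + 1 by omega, pow_succ, pow_mul]; simp
        rcases neg_one_pow_eq_or ℝ k with h | h <;> rw [h] at h1 ⊢ <;> linarith
      rw [e, p]; ring
  rw [hu, Finset.sum_union hd, hs, ← Finset.sum_add_distrib]
  refine Finset.sum_congr rfl fun k _ => ?_
  ring

theorem coord_bracket {n : ℕ} (x y : QAlg n) (j : ℕ) : coord ⁅x, y⁆ j =
    (if 3 ≤ j ∧ j ≤ 2 * n - 1 then coord x 1 * coord y (j - 1) - coord x (j - 1) * coord y 1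
      else 0) +
    (if 1 ≤ j ∧ j = 2 * n then
      ∑ k ∈ Finset.Icc 2 (2 * n - 1), (-1 : ℝ) ^ k * (coord x k * coord y (2 * n + 1 - k))
      else 0) := by
  rw [bracket_def, coord_add, coord_sum, ← Finset.sum_smul, sum_fold, coord_smul]
  congr 1
  · simp only [coord_smul, coord_gen]
    split_ifs with h
    · rw [Finset.sum_eq_single (j - 1)]
      · rw [if_pos (by omega), mul_one]
      · intro b _ hb
        rw [if_neg (by omega), mul_zero]
      · intro hb
        simp only [Finset.mem_Icc] at hb
        omega
    · refine Finset.sum_eq_zero fun i hi => ?_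
      simp only [Finset.mem_Icc] at hi
      rw [if_neg (by omega), mul_zero]
  · rw [coord_gen]
    split_ifs with h1 h2 h2
    · rw [mul_one]
    · omega
    · omega
    · rw [mul_zero]

theorem sum_shift {n : ℕ} (x y z : QAlg n) :
    ∑ k ∈ Finset.Icc 2 (2 * n - 1), (-1 : ℝ) ^ k * (coord x k * coord ⁅y, z⁆ (2 * n + 1 - k)) =
    ∑ k ∈ Finset.Icc 2 (2 * n - 2), (-1 : ℝ) ^ k *
      (coord x k * (coord y 1 * coord z (2 * n - k) - coord y (2 * n - k) * coord z 1)) := by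
  have hsub : Finset.Icc 2 (2 * n - 2) ⊆ Finset.Icc 2 (2 * n - 1) :=
    Finset.Icc_subset_Icc le_rfl (by omega)
  symm
  rw [← Finset.sum_subset hsub]
  · refine Finset.sum_congr rfl fun k hk => ?_
    simp only [Finset.mem_Icc] at hk
    rw [coord_bracket, if_pos (by omega), if_neg (by omega), add_zero,
      show 2 * n + 1 - k - 1 = 2 * n - k by omega]
  · intro k hk hk'
    simp only [Finset.mem_Icc] at hk hk'
    rw [coord_bracket, if_neg (by omega), if_neg (by omega)]
    ring

theorem sum_reflect {n : ℕ} (x y : QAlg n) :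
    ∑ k ∈ Finset.Icc 2 (2 * n - 2), (-1 : ℝ) ^ k * (coord x k * coord y (2 * n - k)) =
    ∑ k ∈ Finset.Icc 2 (2 * n - 2), (-1 : ℝ) ^ k * (coord y k * coord x (2 * n - k)) := by
  refine Finset.sum_nbij' (fun k => 2 * n - k) (fun k => 2 * n - k) ?_ ?_ ?_ ?_ ?_
  · intro k hk; simp only [Finset.mem_Icc] at hk ⊢; omega
  · intro k hk; simp only [Finset.mem_Icc] at hk ⊢; omega
  · intro k hk; simp only [Finset.mem_Icc] at hk ⊢; omega
  · intro k hk; simp only [Finset.mem_Icc] at hk ⊢; omega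
  · intro k hk
    simp only [Finset.mem_Icc] at hk
    have e : 2 * n - (2 * n - k) = k := by omega
    have p : (-1 : ℝ) ^ k = (-1 : ℝ) ^ (2 * n - k) := by
      have h1 : (-1 : ℝ) ^ (2 * n - k) * (-1 : ℝ) ^ k = 1 := by
        rw [← pow_add, show 2 * n - k + k = 2 * n by omega, pow_mul]; simp
      rcases neg_one_pow_eq_or ℝ k with h | h <;> rw [h] at h1 ⊢ <;> linarith
    rw [e, ← p]; ring

theorem bracket_self {n : ℕ} (x : QAlg n) : ⁅x, x⁆ = 0 := by
  rw [bracket_def, Finset.sum_eq_zero, Finset.sum_eq_zero, add_zero]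
  · intro k _
    rw [mul_comm (coord x k), sub_self, mul_zero, zero_smul]
  · intro k _
    rw [mul_comm (coord x k), sub_self, zero_smul]

theorem bracket_add_left {n : ℕ} (x y z : QAlg n) : ⁅x + y, z⁆ = ⁅x, z⁆ + ⁅y, z⁆ := by
  simp only [bracket_def, coord_add]
  rw [add_add_add_comm, ← Finset.sum_add_distrib, ← Finset.sum_add_distrib]
  congr 1 <;> refine Finset.sum_congr rfl fun k _ => ?_ <;> rw [← add_smul] <;> congr 1 <;> ring

theorem bracket_add_right {n : ℕ} (x y z : QAlg n) : ⁅x, y + z⁆ = ⁅x, y⁆ + ⁅x, z⁆ := by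
  simp only [bracket_def, coord_add]
  rw [add_add_add_comm, ← Finset.sum_add_distrib, ← Finset.sum_add_distrib]
  congr 1 <;> refine Finset.sum_congr rfl fun k _ => ?_ <;> rw [← add_smul] <;> congr 1 <;> ring

theorem bracket_smul_right {n : ℕ} (c : ℝ) (x y : QAlg n) : ⁅x, c • y⁆ = c • ⁅x, y⁆ := by
  simp only [bracket_def, coord_smul]
  rw [smul_add, Finset.smul_sum, Finset.smul_sum]
  congr 1 <;> refine Finset.sum_congr rfl fun k _ => ?_ <;> rw [smul_smul] <;> congr 1 <;> ring

theorem bracket_swap {n : ℕ} (x y : QAlg n) : ⁅x, y⁆ = -⁅y, x⁆ := by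
  have h := bracket_self (x + y)
  rw [bracket_add_left, bracket_add_right, bracket_add_right, bracket_self, bracket_self,
    zero_add, add_zero] at h
  exact eq_neg_of_add_eq_zero_left h

theorem jacobi_aux {n : ℕ} (x y z : QAlg n) : ⁅x, ⁅y, z⁆⁆ + ⁅y, ⁅z, x⁆⁆ + ⁅z, ⁅x, y⁆⁆ = 0 := by
  refine ext_coord fun j h1 h2 => ?_
  rw [coord_add, coord_add, coord_zero, coord_bracket x ⁅y, z⁆, coord_bracket y ⁅z, x⁆,
    coord_bracket z ⁅x, y⁆, sum_shift, sum_shift, sum_shift]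
  have c1 : ∀ u v : QAlg n, coord ⁅u, v⁆ 1 = 0 := by
    intro u v
    rw [coord_bracket, if_neg (by omega), if_neg (by omega), add_zero]
  have exp : ∀ u v w : QAlg n, ∑ k ∈ Finset.Icc 2 (2 * n - 2), (-1 : ℝ) ^ k *
      (coord u k * (coord v 1 * coord w (2 * n - k) - coord v (2 * n - k) * coord w 1)) =
      coord v 1 * (∑ k ∈ Finset.Icc 2 (2 * n - 2),
        (-1 : ℝ) ^ k * (coord u k * coord w (2 * n - k))) -
      coord w 1 * ∑ k ∈ Finset.Icc 2 (2 * n - 2),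
        (-1 : ℝ) ^ k * (coord u k * coord v (2 * n - k)) := by
    intro u v w
    rw [Finset.mul_sum, Finset.mul_sum, ← Finset.sum_sub_distrib]
    refine Finset.sum_congr rfl fun k _ => ?_
    ring
  rw [exp, exp, exp, sum_reflect y x, sum_reflect z y, sum_reflect z x]
  simp only [c1]
  split_ifs with h3 h4 h4
  · omega
  · rw [coord_bracket y, coord_bracket z, coord_bracket x]
    split_ifs <;> first | omega | ring
  · ring
  · ring

instance (n : ℕ) : LieRing (QAlg n) where
  add_lie := bracket_add_left
  lie_add := bracket_add_right
  lie_self := bracket_self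
  leibniz_lie x y z := by
    have h := jacobi_aux x y z
    rw [bracket_swap z ⁅x, y⁆, bracket_swap z x] at h
    have h0 : ⁅y, -⁅x, z⁆⁆ = -⁅y, ⁅x, z⁆⁆ := by
      have := bracket_smul_right (-1) y ⁅x, z⁆
      simpa using this
    rw [h0] at h
    have h' : ⁅x, ⁅y, z⁆⁆ - (⁅⁅x, y⁆, z⁆ + ⁅y, ⁅x, z⁆⁆) = 0 := by
      rw [← h]; abel
    exact sub_eq_zero.mp h'

instance (n : ℕ) : LieAlgebra ℝ (QAlg n) where
  lie_smul := bracket_smul_right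

end

end QAlg

/-! ### Invariants of the coadjoint representation -/

section Invariants

variable {ι L : Type*} [Fintype ι] [LieRing L] [LieAlgebra ℝ L]

/-- The differential operator `X̂_i = - C_{ij}^k x_k ∂/∂x_j` (summed over all `j` and `k`), applied
to a function `F` of the coordinates `x` on the dual of the Lie algebra; here
`[X_i, X_j] = C_{ij}^k X_k` in the basis `b = (X_i)`. -/
noncomputable def coadjointOp [DecidableEq ι] (b : Module.Basis ι ℝ L) (i : ι)
    (F : (ι → ℝ) → ℝ) (x : ι → ℝ) : ℝ :=
  -∑ j, ∑ k, b.repr ⁅b i, b j⁆ k * x k * fderiv ℝ F x (Pi.single j 1)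

/-- `F` is a smooth solution of the system `X̂_i F = 0` (for all `i`) on the set `U`
(used for open `U`). -/
def IsInvariantOn [DecidableEq ι] (b : Module.Basis ι ℝ L) (U : Set (ι → ℝ))
    (F : (ι → ℝ) → ℝ) : Prop :=
  ContDiffOn ℝ ∞ F U ∧ ∀ i, ∀ x ∈ U, coadjointOp b i F x = 0

/-- Functional independence on `U`: the differentials are linearly independent at the points of a
dense subset of `U`. -/
def FunctionallyIndependentOn {κ : Type*} (U : Set (ι → ℝ)) (F : κ → (ι → ℝ) → ℝ) : Prop :=
  U ⊆ closure {x ∈ U | LinearIndependent ℝ fun a => fderiv ℝ (F a) x}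

/-- A functionally independent family of invariants on `U`. -/
def IsIndependentInvariantsOn [DecidableEq ι] {κ : Type*} (b : Module.Basis ι ℝ L)
    (U : Set (ι → ℝ)) (F : κ → (ι → ℝ) → ℝ) : Prop :=
  (∀ a, IsInvariantOn b U (F a)) ∧ FunctionallyIndependentOn U F

/-- A fundamental set of invariants on `U`: a functionally independent family of invariants that
cannot be enlarged. -/
def IsFundamentalSetOn [DecidableEq ι] {m : ℕ} (b : Module.Basis ι ℝ L)
    (U : Set (ι → ℝ)) (F : Fin m → (ι → ℝ) → ℝ) : Prop :=
  IsIndependentInvariantsOn b U F ∧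
    ∀ G : (ι → ℝ) → ℝ, IsInvariantOn b U G →
      ¬ FunctionallyIndependentOn U (Fin.snoc F G : Fin (m + 1) → (ι → ℝ) → ℝ)

end Invariants

/-! ### Symmetrization -/

section Symmetrization

variable {ι L : Type*} [LieRing L] [LieAlgebra ℝ L]

/-- `(1 / r!) ∑_σ X_{i_σ(1)} ⋯ X_{i_σ(r)}`, in the universal enveloping algebra, for the list
`[i_1, …, i_r]`; the sum is over all `r!` permutations of the positions. -/
noncomputable def symmetrizedProd (b : Module.Basis ι ℝ L) (l : List ι) :
    UniversalEnvelopingAlgebra ℝ L :=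
  ((l.length.factorial : ℝ)⁻¹) •
    (l.permutations.map fun l' =>
      (l'.map fun i => UniversalEnvelopingAlgebra.ι ℝ (b i)).prod).sum

/-- The symmetrization map from polynomials in the coordinates `x_i` to the universal enveloping
algebra: the linear map that sends each monomial `x_{i_1} ⋯ x_{i_r}` to the average of the products
of `X_{i_1}, …, X_{i_r}` in all orders. -/
noncomputable def symmetrization (b : Module.Basis ι ℝ L) :
    MvPolynomial ι ℝ →ₗ[ℝ] UniversalEnvelopingAlgebra ℝ L :=
  (MvPolynomial.basisMonomials ι ℝ).constr ℝ fun s =>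
    symmetrizedProd b (Finsupp.toMultiset s).toList

end Symmetrization

/-! ### The two invariants of `Q_{2n}` -/

namespace QAlg

/-- The polynomial variable `x_k`, `1 ≤ k ≤ 2n`. -/
noncomputable def var (n k : ℕ) : MvPolynomial (Fin (2 * n)) ℝ :=
  oneBased (fun i : Fin (2 * n) => (MvPolynomial.X i : MvPolynomial (Fin (2 * n)) ℝ)) k

/-- `I_1 = x_{2n}`. -/
noncomputable def I₁ (n : ℕ) : MvPolynomial (Fin (2 * n)) ℝ := var n (2 * n)

/-- `I_2 = x_1 x_{2n} + x_3 x_{2n-1} + ∑_{k=4}^n (-1)^{k+1} x_k x_{2n+2-k}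
+ ((-1)^n / 2) x_{n+1}^2`. -/
noncomputable def I₂ (n : ℕ) : MvPolynomial (Fin (2 * n)) ℝ :=
  var n 1 * var n (2 * n) + var n 3 * var n (2 * n - 1) +
    (∑ k ∈ Finset.Icc 4 n, (-1 : ℝ) ^ (k + 1) • (var n k * var n (2 * n + 2 - k))) +
    ((-1 : ℝ) ^ n / 2) • var n (n + 1) ^ 2

/-- The generator `X_k`, `1 ≤ k ≤ 2n`, in the universal enveloping algebra of `Q_{2n}`. -/
noncomputable def genU (n k : ℕ) : UniversalEnvelopingAlgebra ℝ (QAlg n) :=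
  UniversalEnvelopingAlgebra.ι ℝ (gen n k)

end QAlg

/-! Up to sign, $\widehat X_i$ acts on polynomials as the derivation extending $\mathrm{ad}\,X_i$,
so invariance of $I_1$ and $I_2$ and centrality of their symmetrizations are the same computation in
two algebras. It is done once, in `map_quadratic`, for any derivation of an algebra acting on
elements $g_k$ by the bracket table. The key form is $I_2 =
g_1g_{2n}+\frac12\sum_{k=3}^{2n-1}(-1)^{k+1}g_kg_{2n+2-k}$. Under $X_1$ the derivative of the sum
cancels after a shift of index. Under $X_i$ with $2\le i\le 2n-2$ two terms of the sum survive, and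
together they cancel $[X_i,X_1]X_{2n}=-X_{i+1}X_{2n}$.

In the enveloping algebra the two factors of every monomial of $I_2$ commute, so symmetrization
merely replaces $x_k$ by $X_k$.

For the count, take a point with $x_{2n}\ne0$; such points are dense. There $dI_1$ and $dI_2$ are
independent, as seen from the directions $1$ and $2n$. Conversely, the equation for $X_{2n+1-j}$
expresses the $j$-th component of the differential of an invariant through its first component, so
that differential is determined by two of its components (`card_le_two_of_independent`). -/

namespace QAlg

/-- The bracket `[X_i, X_m]` of `Q_{2n}`, with the generators `X_k` replaced by the elements `g k`
of a real vector space. -/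
noncomputable def genBracket {A : Type*} [AddCommGroup A] [Module ℝ A] (n : ℕ) (g : ℕ → A)
    (i m : ℕ) : A :=
  if i = 1 then (if 2 ≤ m ∧ m ≤ 2 * n - 2 then g (m + 1) else 0)
  else if m = 1 then (if 2 ≤ i ∧ i ≤ 2 * n - 2 then -g (i + 1) else 0)
  else if i + m = 2 * n + 1 then (-1 : ℝ) ^ i • g (2 * n) else 0

/-- The table is linear in the generators, so it carries over to the enveloping algebra, to
polynomials and to values at a point. -/
theorem map_genBracket {A B : Type*} [AddCommGroup A] [Module ℝ A] [AddCommGroup B] [Module ℝ B]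
    (f : A →ₗ[ℝ] B) (n : ℕ) (g : ℕ → A) (i m : ℕ) :
    f (genBracket n g i m) = genBracket n (fun k => f (g k)) i m := by
  unfold genBracket
  split_ifs <;> simp

/-- The sign $(-1)^i$ serves both orders of a pair with $i+m=2n+1$, because $i$ and $m$ then have
opposite parity. The cases $i=1$ and $m=1$ come first in the table, which keeps the pair $(1,2n)$
out of the last case. -/
theorem lie_gen {n i m : ℕ} (hi : 1 ≤ i) (hi' : i ≤ 2 * n) (hm : 1 ≤ m) (hm' : m ≤ 2 * n) :
    ⁅gen n i, gen n m⁆ = genBracket n (gen n) i m := by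
  refine ext_coord fun j hj hj' => ?_
  have hsum : ∑ k ∈ Finset.Icc 2 (2 * n - 1),
      (-1 : ℝ) ^ k * (coord (gen n i) k * coord (gen n m) (2 * n + 1 - k)) =
      if 2 ≤ i ∧ i ≤ 2 * n - 1 ∧ i + m = 2 * n + 1 then (-1 : ℝ) ^ i else 0 := by
    split_ifs with h
    · rw [Finset.sum_eq_single i]
      · rw [coord_gen, coord_gen, if_pos (by omega), if_pos (by omega), mul_one, mul_one]
      · intro k _ hk
        rw [coord_gen, if_neg (by omega)]
        ring
      · intro h'
        simp only [Finset.mem_Icc] at h'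
        omega
    · refine Finset.sum_eq_zero fun k hk => ?_
      simp only [Finset.mem_Icc] at hk
      rw [coord_gen, coord_gen]
      by_cases hik : i = k
      · rw [if_neg (c := m = _ ∧ _) (by omega)]
        ring
      · rw [if_neg (by omega)]
        ring
  rw [coord_bracket, hsum]
  have hz : coord (0 : QAlg n) j = 0 := coord_zero j
  have hneg : ∀ k, coord (-gen n k) j = -coord (gen n k) j := fun k => by
    simpa using coord_smul (-1) (gen n k) j
  unfold genBracket
  by_cases h1 : i = 1
  · subst h1
    rw [if_pos rfl, if_neg (c := 2 ≤ 1 ∧ _) (by omega)]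
    simp only [coord_gen, ite_self, add_zero, true_and]
    rw [apply_ite (fun v => coord v j), coord_gen, hz]
    split_ifs <;> first | omega | norm_num
  · rw [if_neg h1]
    by_cases h2 : m = 1
    · subst h2
      rw [if_pos rfl, if_neg (c := 2 ≤ i ∧ i ≤ 2 * n - 1 ∧ _) (by omega)]
      simp only [coord_gen, ite_self, add_zero, true_and]
      rw [apply_ite (fun v => coord v j), hneg, coord_gen, hz]
      split_ifs <;> first | omega | norm_num
    · rw [if_neg h2, apply_ite (fun v => coord v j), coord_smul, hz]
      simp only [coord_gen]
      split_ifs <;> first | omega | norm_num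

/-! ### Derivations annihilating the quadratic element -/

section Quadratic

variable {A : Type*} [Ring A] [Algebra ℝ A]

/-- The expression `I_2`, with the variables `x_k` replaced by the elements `g k` of an algebra. -/
noncomputable def quadratic (n : ℕ) (g : ℕ → A) : A :=
  g 1 * g (2 * n) + g 3 * g (2 * n - 1) +
    (∑ k ∈ Finset.Icc 4 n, (-1 : ℝ) ^ (k + 1) • (g k * g (2 * n + 2 - k))) +
    ((-1 : ℝ) ^ n / 2) • g (n + 1) ^ 2

theorem neg_one_pow_congr {a b : ℕ} (h : Even (a + b)) : (-1 : ℝ) ^ a = (-1 : ℝ) ^ b := by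
  have h1 : (-1 : ℝ) ^ a * (-1 : ℝ) ^ b = 1 := by rw [← pow_add, h.neg_one_pow]
  rcases neg_one_pow_eq_or ℝ a with h | h <;> rw [h] at h1 ⊢ <;> linarith

/-- The quadratic expression as one sum over a range symmetric under `k ↦ 2n + 2 - k`. -/
theorem quadratic_eq_sum {n : ℕ} (hn : 3 ≤ n) {g : ℕ → A}
    (hg : ∀ k, 3 ≤ k → k ≤ 2 * n - 1 → Commute (g k) (g (2 * n + 2 - k))) :
    quadratic n g = g 1 * g (2 * n) + (1 / 2 : ℝ) •
      ∑ k ∈ Finset.Icc 3 (2 * n - 1), (-1 : ℝ) ^ (k + 1) • (g k * g (2 * n + 2 - k)) := by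
  -- The reflection $k\mapsto 2n+2-k$ exchanges the two outer intervals and fixes $n+1$. It
  -- preserves the parity of $k$ and the paired factors commute, so each product off the centre is
  -- counted twice, whence the factor $\frac12$.
  have hu : Finset.Icc 3 (2 * n - 1) =
      (Finset.Icc 3 n ∪ Finset.Icc (n + 2) (2 * n - 1)) ∪ {n + 1} := by
    ext k; simp only [Finset.mem_union, Finset.mem_Icc, Finset.mem_singleton]; omega
  have hd : Disjoint (Finset.Icc 3 n ∪ Finset.Icc (n + 2) (2 * n - 1)) {n + 1} := by
    rw [Finset.disjoint_left]; intro k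
    simp only [Finset.mem_union, Finset.mem_Icc, Finset.mem_singleton]; omega
  have hd' : Disjoint (Finset.Icc 3 n) (Finset.Icc (n + 2) (2 * n - 1)) := by
    rw [Finset.disjoint_left]; intro k; simp only [Finset.mem_Icc]; omega
  have hs : ∑ k ∈ Finset.Icc (n + 2) (2 * n - 1), (-1 : ℝ) ^ (k + 1) • (g k * g (2 * n + 2 - k)) =
      ∑ k ∈ Finset.Icc 3 n, (-1 : ℝ) ^ (k + 1) • (g k * g (2 * n + 2 - k)) := by
    refine Finset.sum_nbij' (fun k => 2 * n + 2 - k) (fun k => 2 * n + 2 - k) ?_ ?_ ?_ ?_ ?_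
    · intro k hk; simp only [Finset.mem_Icc] at hk ⊢; omega
    · intro k hk; simp only [Finset.mem_Icc] at hk ⊢; omega
    · intro k hk; simp only [Finset.mem_Icc] at hk ⊢; omega
    · intro k hk; simp only [Finset.mem_Icc] at hk ⊢; omega
    · intro k hk
      simp only [Finset.mem_Icc] at hk
      rw [show 2 * n + 2 - (2 * n + 2 - k) = k by omega, (hg k (by omega) (by omega)).eq,
        neg_one_pow_congr (a := k + 1) (b := 2 * n + 2 - k + 1) ⟨n + 2, by omega⟩]
  -- The term $k=3$ stands apart in the original expression; its sign is $(-1)^4=1$.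
  have h3 : Finset.Icc 3 n = insert 3 (Finset.Icc 4 n) := by
    ext k; simp only [Finset.mem_insert, Finset.mem_Icc]; omega
  rw [hu, Finset.sum_union hd, Finset.sum_union hd', hs, Finset.sum_singleton, h3,
    Finset.sum_insert (by simp), quadratic, show 2 * n + 2 - 3 = 2 * n - 1 by omega,
    show 2 * n + 2 - (n + 1) = n + 1 by omega,
    neg_one_pow_congr (a := n + 1 + 1) (b := n) ⟨n + 1, by omega⟩, sq]
  norm_num
  module

variable {n i : ℕ} {g : ℕ → A} {D : A →ₗ[ℝ] A}

/-- A derivation that acts on the `g k` as `X_1` acts on the generators of `Q_{2n}` annihilates the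
quadratic expression. -/
theorem map_quadratic_of_one (hn : 3 ≤ n) (hD : ∀ a b, D (a * b) = D a * b + a * D b)
    (hg : ∀ m, 1 ≤ m → m ≤ 2 * n → D (g m) = genBracket n g 1 m)
    (hc : ∀ k, 3 ≤ k → k ≤ 2 * n - 1 → Commute (g k) (g (2 * n + 2 - k))) :
    D (quadratic n g) = 0 := by
  have h1 : D (g 1) = 0 := by simp [hg 1 le_rfl (by omega), genBracket]
  have h2 : D (g (2 * n)) = 0 := by
    rw [hg _ (by omega) le_rfl, genBracket, if_pos rfl, if_neg (by omega)]
  -- The top term drops out because $[X_1,X_{2n-1}]=0$; in `hB` the term $k=3$ drops out for the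
  -- same reason, its second factor being $g_{2n-1}$.
  have hA : ∑ k ∈ Finset.Icc 3 (2 * n - 1), (-1 : ℝ) ^ (k + 1) • (D (g k) * g (2 * n + 2 - k)) =
      ∑ k ∈ Finset.Icc 3 (2 * n - 2), (-1 : ℝ) ^ (k + 1) • (g (k + 1) * g (2 * n + 2 - k)) := by
    symm
    rw [← Finset.sum_subset (Finset.Icc_subset_Icc le_rfl (by omega : 2 * n - 2 ≤ 2 * n - 1))]
    · refine Finset.sum_congr rfl fun k hk => ?_
      simp only [Finset.mem_Icc] at hk
      rw [hg k (by omega) (by omega), genBracket, if_pos rfl, if_pos (by omega)]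
    · intro k hk hk'
      simp only [Finset.mem_Icc] at hk hk'
      rw [hg k (by omega) (by omega), genBracket, if_pos rfl, if_neg (by omega)]
      simp
  have hB : ∑ k ∈ Finset.Icc 3 (2 * n - 1), (-1 : ℝ) ^ (k + 1) • (g k * D (g (2 * n + 2 - k))) =
      ∑ k ∈ Finset.Icc 4 (2 * n - 1), (-1 : ℝ) ^ (k + 1) • (g k * g (2 * n + 2 - k + 1)) := by
    symm
    rw [← Finset.sum_subset (Finset.Icc_subset_Icc (by omega : 3 ≤ 4) le_rfl)]
    · refine Finset.sum_congr rfl fun k hk => ?_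
      simp only [Finset.mem_Icc] at hk
      rw [hg _ (by omega) (by omega), genBracket, if_pos rfl, if_pos (by omega)]
    · intro k hk hk'
      simp only [Finset.mem_Icc] at hk hk'
      rw [hg _ (by omega) (by omega), genBracket, if_pos rfl, if_neg (by omega)]
      simp
  -- Lowering the index by one turns one half of the Leibniz rule into the negative of the other.
  have hBA : ∑ k ∈ Finset.Icc 4 (2 * n - 1), (-1 : ℝ) ^ (k + 1) • (g k * g (2 * n + 2 - k + 1)) =
      ∑ k ∈ Finset.Icc 3 (2 * n - 2), -((-1 : ℝ) ^ (k + 1) • (g (k + 1) * g (2 * n + 2 - k))) := by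
    refine Finset.sum_nbij' (fun k => k - 1) (fun k => k + 1) ?_ ?_ ?_ ?_ ?_
    · intro k hk; simp only [Finset.mem_Icc] at hk ⊢; omega
    · intro k hk; simp only [Finset.mem_Icc] at hk ⊢; omega
    · intro k hk; simp only [Finset.mem_Icc] at hk ⊢; omega
    · intro k hk; simp only [Finset.mem_Icc] at hk ⊢; omega
    · intro k hk
      simp only [Finset.mem_Icc] at hk
      rw [show k - 1 + 1 = k by omega, show 2 * n + 2 - (k - 1) = 2 * n + 2 - k + 1 by omega,
        pow_succ, mul_neg_one, neg_smul]
  rw [quadratic_eq_sum hn hc, map_add, hD, h1, h2, map_smul, map_sum]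
  simp only [map_smul, hD, smul_add]
  rw [Finset.sum_add_distrib, hA, hB, hBA, Finset.sum_neg_distrib]
  simp

/-- A derivation that acts on the `g k` as `X_i` with `2 ≤ i` acts on the generators of `Q_{2n}`
annihilates the quadratic expression. -/
theorem map_quadratic_of_two_le (hn : 3 ≤ n) (hi : 2 ≤ i) (hi' : i ≤ 2 * n)
    (hD : ∀ a b, D (a * b) = D a * b + a * D b)
    (hg : ∀ m, 1 ≤ m → m ≤ 2 * n → D (g m) = genBracket n g i m)
    (hc : ∀ k, 3 ≤ k → k ≤ 2 * n - 1 → Commute (g k) (g (2 * n + 2 - k)))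
    (hz : ∀ k, 1 ≤ k → k ≤ 2 * n → Commute (g k) (g (2 * n))) :
    D (quadratic n g) = 0 := by
  have h2 : D (g (2 * n)) = 0 := by
    rw [hg _ (by omega) le_rfl, genBracket, if_neg (by omega), if_neg (by omega),
      if_neg (by omega)]
  rw [quadratic_eq_sum hn hc, map_add, hD, h2, map_smul, map_sum]
  simp only [map_smul, hD, smul_add]
  rw [Finset.sum_add_distrib]
  by_cases h : i ≤ 2 * n - 2
  · have h1 : D (g 1) = -g (i + 1) := by
      rw [hg 1 le_rfl (by omega), genBracket, if_neg (by omega), if_pos rfl, if_pos ⟨hi, h⟩]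
    -- Only $g_{2n+1-i}$ has a nonzero image among $g_3,\dots,g_{2n-1}$. It occurs once as a left
    -- factor ($k=2n+1-i$) and once as a right factor ($k=i+1$). Both signs come out as $+1$, so the
    -- two halves add up to $g_{i+1}g_{2n}$.
    rw [Finset.sum_eq_single (2 * n + 1 - i), Finset.sum_eq_single (i + 1),
      hg (2 * n + 1 - i) (by omega) (by omega), hg (2 * n + 2 - (i + 1)) (by omega) (by omega), h1]
    · unfold genBracket
      rw [if_neg (by omega), if_neg (by omega), if_pos (by omega), if_neg (by omega),
        if_neg (by omega), if_pos (by omega), show 2 * n + 2 - (2 * n + 1 - i) = i + 1 by omega,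
        neg_one_pow_congr (a := 2 * n + 1 - i + 1) (b := i) ⟨n + 1, by omega⟩,
        neg_one_pow_congr (a := i + 1 + 1) (b := i) ⟨i + 1, by omega⟩]
      have hs : (-1 : ℝ) ^ i * (-1 : ℝ) ^ i = 1 := by rw [← pow_add, Even.neg_one_pow ⟨i, rfl⟩]
      simp only [mul_zero, neg_mul, smul_mul_assoc, mul_smul_comm, smul_smul, hs,
        (hz (i + 1) (by omega) (by omega)).eq]
      module
    · intro k hk hki
      simp only [Finset.mem_Icc] at hk
      rw [hg _ (by omega) (by omega), genBracket, if_neg (by omega), if_neg (by omega),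
        if_neg (by omega), mul_zero, smul_zero]
    · intro hk; simp only [Finset.mem_Icc] at hk; omega
    · intro k hk hki
      simp only [Finset.mem_Icc] at hk
      rw [hg _ (by omega) (by omega), genBracket, if_neg (by omega), if_neg (by omega),
        if_neg (by omega), zero_mul, smul_zero]
    · intro hk; simp only [Finset.mem_Icc] at hk; omega
  -- For $i\ge 2n-1$ the partner index $2n+1-i$ is at most $2$, outside the range of the sum.
  · have h1 : D (g 1) = 0 := by
      rw [hg 1 le_rfl (by omega), genBracket, if_neg (by omega), if_pos rfl, if_neg (by omega)]
    rw [Finset.sum_eq_zero, Finset.sum_eq_zero, h1]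
    · simp
    · intro k hk
      simp only [Finset.mem_Icc] at hk
      rw [hg _ (by omega) (by omega), genBracket, if_neg (by omega), if_neg (by omega),
        if_neg (by omega), mul_zero, smul_zero]
    · intro k hk
      simp only [Finset.mem_Icc] at hk
      rw [hg _ (by omega) (by omega), genBracket, if_neg (by omega), if_neg (by omega),
        if_neg (by omega), zero_mul, smul_zero]

theorem map_quadratic (hn : 3 ≤ n) (hi : 1 ≤ i) (hi' : i ≤ 2 * n)
    (hD : ∀ a b, D (a * b) = D a * b + a * D b)
    (hg : ∀ m, 1 ≤ m → m ≤ 2 * n → D (g m) = genBracket n g i m)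
    (hc : ∀ k, 3 ≤ k → k ≤ 2 * n - 1 → Commute (g k) (g (2 * n + 2 - k)))
    (hz : ∀ k, 1 ≤ k → k ≤ 2 * n → Commute (g k) (g (2 * n))) :
    D (quadratic n g) = 0 := by
  rcases hi.eq_or_lt with rfl | hi
  · exact map_quadratic_of_one hn hD hg hc
  · exact map_quadratic_of_two_le hn hi hi' hD hg hc hz

end Quadratic

end QAlg

/-! ### The universal enveloping algebra -/

attribute [local instance] LieRing.ofAssociativeRing LieAlgebra.ofAssociativeAlgebra

section Enveloping

open UniversalEnvelopingAlgebra

variable {L : Type*} [LieRing L] [LieAlgebra ℝ L]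

theorem UniversalEnvelopingAlgebra.ι_lie (x y : L) :
    ι ℝ ⁅x, y⁆ = ι ℝ x * ι ℝ y - ι ℝ y * ι ℝ x :=
  (LieHom.map_lie (ι ℝ) x y).trans (LieRing.of_associative_ring_bracket _ _)

theorem UniversalEnvelopingAlgebra.commute_ι {x y : L} (h : ⁅x, y⁆ = 0) :
    Commute (ι ℝ x) (ι ℝ y) := by
  have := ι_lie x y
  rw [h, map_zero] at this
  exact sub_eq_zero.mp this.symm

/-- An element that commutes with the elements of a Lie algebra is central in its universal
enveloping algebra. -/
theorem UniversalEnvelopingAlgebra.mem_center_of_commute {z : UniversalEnvelopingAlgebra ℝ L}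
    (h : ∀ x : L, Commute (ι ℝ x) z) :
    z ∈ Subalgebra.center ℝ (UniversalEnvelopingAlgebra ℝ L) := by
  -- The centralizer $S$ of $z$ contains the image of $L$. By the universal property the map $L\to
  -- S$ extends to the whole enveloping algebra, and following it by the inclusion gives the
  -- identity, so $S$ is everything.
  let S : Subalgebra ℝ (UniversalEnvelopingAlgebra ℝ L) := Subalgebra.centralizer ℝ {z}
  have hS : ∀ x : L, ι ℝ x ∈ S := fun x => by
    rw [Subalgebra.mem_centralizer_iff]
    intro g hg
    rw [Set.mem_singleton_iff.mp hg]
    exact (h x).eq.symm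
  let f : L →ₗ⁅ℝ⁆ S :=
    { toFun := fun x => ⟨ι ℝ x, hS x⟩
      map_add' := fun x y => Subtype.ext (map_add (ι ℝ) x y)
      map_smul' := fun c x => Subtype.ext (map_smul (ι ℝ) c x)
      map_lie' := fun {x y} => Subtype.ext (ι_lie x y) }
  have hid : S.val.comp (lift ℝ f) = AlgHom.id ℝ _ := by
    refine hom_ext ℝ (LieHom.ext fun x => ?_)
    change ((lift ℝ f (ι ℝ x) : S) : UniversalEnvelopingAlgebra ℝ L) = ι ℝ x
    rw [lift_ι_apply]
    rfl
  rw [Subalgebra.mem_center_iff]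
  intro b
  have hb : b ∈ S := by
    have := DFunLike.congr_fun hid b
    change ((lift ℝ f b : S) : UniversalEnvelopingAlgebra ℝ L) = b at this
    rw [← this]
    exact (lift ℝ f b).2
  exact ((Subalgebra.mem_centralizer_iff ℝ).mp hb z rfl).symm

theorem UniversalEnvelopingAlgebra.mem_center_of_commute_basis {ι' : Type*}
    (b : Module.Basis ι' ℝ L) {z : UniversalEnvelopingAlgebra ℝ L}
    (h : ∀ i, Commute (ι ℝ (b i)) z) :
    z ∈ Subalgebra.center ℝ (UniversalEnvelopingAlgebra ℝ L) := by
  refine mem_center_of_commute fun x => ?_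
  -- Commutation with $z$ is a linear condition on $x$, so a basis suffices.
  have : (LinearMap.mulRight ℝ z - LinearMap.mulLeft ℝ z) ∘ₗ
      (ι ℝ : L →ₗ⁅ℝ⁆ UniversalEnvelopingAlgebra ℝ L).toLinearMap = 0 :=
    b.ext fun i => sub_eq_zero.mpr (h i).eq
  exact sub_eq_zero.mp (LinearMap.congr_fun this x)

theorem symmetrization_monomial {ι' : Type*} (b : Module.Basis ι' ℝ L) (s : ι' →₀ ℕ) :
    symmetrization b (MvPolynomial.monomial s 1) =
      symmetrizedProd b (Finsupp.toMultiset s).toList :=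
  (MvPolynomial.basisMonomials ι' ℝ).constr_basis ℝ _ s

theorem symmetrization_X {ι' : Type*} (b : Module.Basis ι' ℝ L) (i : ι') :
    symmetrization b (MvPolynomial.X i) = ι ℝ (b i) := by
  rw [MvPolynomial.X, symmetrization_monomial,
    Finsupp.toMultiset_single, one_smul, Multiset.toList_singleton]
  simp [symmetrizedProd, List.permutations, List.permutationsAux, List.permutationsAux.rec]

/-- `Multiset.toList` lists the variables of a monomial in an unspecified order; the average does
not depend on it. -/
theorem symmetrizedProd_perm {ι' : Type*} (b : Module.Basis ι' ℝ L) {l l' : List ι'}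
    (h : l.Perm l') : symmetrizedProd b l = symmetrizedProd b l' := by
  rw [symmetrizedProd, symmetrizedProd, h.length_eq, (h.permutations.map _).sum_eq]

/-- The case $i=j$ is included: permutations are of positions, so the square is counted twice and
halved. -/
theorem symmetrization_X_mul_X {ι' : Type*} (b : Module.Basis ι' ℝ L) (i j : ι') :
    symmetrization b (MvPolynomial.X i * MvPolynomial.X j) =
      (1 / 2 : ℝ) • (ι ℝ (b i) * ι ℝ (b j) + ι ℝ (b j) * ι ℝ (b i)) := by
  have hp : (Finsupp.toMultiset (Finsupp.single i 1 + Finsupp.single j 1)).toList.Perm [i, j] := by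
    rw [← Multiset.coe_eq_coe, Multiset.coe_toList, map_add, Finsupp.toMultiset_single,
      Finsupp.toMultiset_single, one_smul, one_smul]
    rfl
  rw [MvPolynomial.X, MvPolynomial.X, MvPolynomial.monomial_mul, mul_one,
    symmetrization_monomial,
    symmetrizedProd_perm b hp]
  simp [symmetrizedProd, List.permutations, List.permutationsAux, List.permutationsAux.rec]

theorem symmetrization_X_mul_X_of_commute {ι' : Type*} (b : Module.Basis ι' ℝ L) {i j : ι'}
    (h : Commute (ι ℝ (b i)) (ι ℝ (b j))) :
    symmetrization b (MvPolynomial.X i * MvPolynomial.X j) = ι ℝ (b i) * ι ℝ (b j) := by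
  rw [symmetrization_X_mul_X, ← h.eq]
  module

end Enveloping

/-! ### Casimir operators of $Q_{2n}$ -/

namespace QAlg

variable {n : ℕ}

theorem lie_gen_eq_zero {i m : ℕ} (hi : 2 ≤ i) (hi' : i ≤ 2 * n) (hm : 2 ≤ m)
    (hm' : m ≤ 2 * n) (h : i + m ≠ 2 * n + 1) : ⁅gen n i, gen n m⁆ = 0 := by
  rw [lie_gen (by omega) hi' (by omega) hm', genBracket, if_neg (by omega), if_neg (by omega),
    if_neg h]

theorem lie_gen_last {i : ℕ} (hi : 1 ≤ i) (hi' : i ≤ 2 * n) : ⁅gen n i, gen n (2 * n)⁆ = 0 := by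
  rw [lie_gen hi hi' (by omega) le_rfl, genBracket]
  split_ifs <;> first | rfl | omega

theorem basis_eq_gen (i : Fin (2 * n)) : basis n i = gen n (i + 1) := by
  have hi : (i : ℕ) + 1 ≤ 2 * n := i.2
  simp [gen, oneBased, hi]

theorem gen_eq_basis {k : ℕ} (h : 1 ≤ k) (h' : k ≤ 2 * n) :
    gen n k = basis n ⟨k - 1, by omega⟩ := by
  simp [gen, oneBased, h, h']

theorem var_eq_X {k : ℕ} (h : 1 ≤ k) (h' : k ≤ 2 * n) :
    var n k = MvPolynomial.X ⟨k - 1, by omega⟩ := by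
  simp [var, oneBased, h, h']

theorem symmetrization_var {k : ℕ} (h : 1 ≤ k) (h' : k ≤ 2 * n) :
    symmetrization (basis n) (var n k) = genU n k := by
  rw [var_eq_X h h', symmetrization_X, genU, gen_eq_basis h h']

theorem symmetrization_var_mul_var {k m : ℕ} (h : 1 ≤ k) (h' : k ≤ 2 * n) (hm : 1 ≤ m)
    (hm' : m ≤ 2 * n) (hc : Commute (genU n k) (genU n m)) :
    symmetrization (basis n) (var n k * var n m) = genU n k * genU n m := by
  rw [genU, genU, gen_eq_basis h h', gen_eq_basis hm hm'] at hc ⊢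
  rw [var_eq_X h h', var_eq_X hm hm', symmetrization_X_mul_X_of_commute _ hc]

theorem commute_genU_last {k : ℕ} (h : 1 ≤ k) (h' : k ≤ 2 * n) :
    Commute (genU n k) (genU n (2 * n)) :=
  UniversalEnvelopingAlgebra.commute_ι (lie_gen_last h h')

/-- The indices sum to $2n+2$ rather than $2n+1$, and neither of them is $1$. -/
theorem commute_genU_reflect {k : ℕ} (h : 3 ≤ k) (h' : k ≤ 2 * n - 1) :
    Commute (genU n k) (genU n (2 * n + 2 - k)) :=
  UniversalEnvelopingAlgebra.commute_ι
    (lie_gen_eq_zero (by omega) (by omega) (by omega) (by omega) (by omega))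

theorem symmetrization_I₂ (hn : 3 ≤ n) :
    symmetrization (basis n) (I₂ n) = quadratic n (genU n) := by
  rw [I₂, quadratic, map_add, map_add, map_add, map_sum, map_smul, sq, sq,
    symmetrization_var_mul_var le_rfl (by omega) (by omega) le_rfl
      (commute_genU_last le_rfl (by omega)),
    symmetrization_var_mul_var (by omega) (by omega) (by omega) (by omega),
    symmetrization_var_mul_var (by omega) (by omega) (by omega) (by omega) (Commute.refl _)]
  · congr 2
    refine Finset.sum_congr rfl fun k hk => ?_
    simp only [Finset.mem_Icc] at hk
    rw [map_smul, symmetrization_var_mul_var (by omega) (by omega) (by omega) (by omega)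
      (commute_genU_reflect (by omega) (by omega))]
  · exact commute_genU_reflect le_rfl (by omega)

theorem genU_last_mem_center :
    genU n (2 * n) ∈ Subalgebra.center ℝ (UniversalEnvelopingAlgebra ℝ (QAlg n)) := by
  refine UniversalEnvelopingAlgebra.mem_center_of_commute_basis (basis n) fun i => ?_
  rw [basis_eq_gen]
  exact commute_genU_last (by omega) (by omega)

theorem quadratic_genU_mem_center (hn : 3 ≤ n) :
    quadratic n (genU n) ∈ Subalgebra.center ℝ (UniversalEnvelopingAlgebra ℝ (QAlg n)) := by
  refine UniversalEnvelopingAlgebra.mem_center_of_commute_basis (basis n) fun i => ?_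
  rw [basis_eq_gen]
  set u : UniversalEnvelopingAlgebra ℝ (QAlg n) := genU n (i + 1) with hu
  -- The derivation here is the commutator with $X_{i+1}$ ($i$ counts from $0$).
  have := map_quadratic (i := (i : ℕ) + 1) (g := genU n)
    (D := LinearMap.mulLeft ℝ u - LinearMap.mulRight ℝ u) hn (by omega) (by omega)
    (fun a b => by
      simp only [LinearMap.sub_apply, LinearMap.mulLeft_apply, LinearMap.mulRight_apply]
      noncomm_ring)
    (fun m hm hm' => by
      rw [LinearMap.sub_apply, LinearMap.mulLeft_apply, LinearMap.mulRight_apply, hu, genU, genU,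
        ← UniversalEnvelopingAlgebra.ι_lie, lie_gen (by omega) (by omega) hm hm']
      exact map_genBracket (UniversalEnvelopingAlgebra.ι ℝ).toLinearMap _ _ _ _)
    (fun k h h' => commute_genU_reflect h h') (fun k h h' => commute_genU_last h h')
  exact sub_eq_zero.mp this

end QAlg

/-! ### Differentials of polynomials and of invariants -/

namespace MvPolynomial

variable {ι : Type*} [Fintype ι]

theorem contDiff_eval (P : MvPolynomial ι ℝ) : ContDiff ℝ ∞ fun x : ι → ℝ => eval x P := by
  induction P using MvPolynomial.induction_on with
  | C a => simpa using contDiff_const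
  | add p q hp hq => simpa using hp.add hq
  | mul_X p i hp => simpa using hp.mul (contDiff_apply ℝ ℝ i)

theorem fderiv_eval [DecidableEq ι] (P : MvPolynomial ι ℝ) (x : ι → ℝ) (j : ι) :
    fderiv ℝ (fun y : ι → ℝ => eval y P) x (Pi.single j 1) = eval x (pderiv j P) := by
  have hd : ∀ Q : MvPolynomial ι ℝ, DifferentiableAt ℝ (fun y : ι → ℝ => eval y Q) x :=
    fun Q => (contDiff_eval Q).contDiffAt.differentiableAt (by simp)
  induction P using MvPolynomial.induction_on with
  | C a => simp
  | add p q hp hq =>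
    simp only [map_add]
    rw [← hp, ← hq, fderiv_fun_add (hd p) (hd q)]
    rfl
  | mul_X p i hp =>
    have hX : fderiv ℝ (fun y : ι → ℝ => y i) x = ContinuousLinearMap.proj i :=
      (ContinuousLinearMap.proj (R := ℝ) (φ := fun _ : ι => ℝ) i).fderiv
    have hXd := hd (X i)
    simp only [eval_X] at hXd
    simp only [map_mul, eval_X]
    rw [fderiv_fun_mul (hd p) hXd, hX, Derivation.leibniz, pderiv_X]
    simp only [add_apply, smul_apply, hp, smul_eq_mul,
      ContinuousLinearMap.proj_apply, map_add, map_mul, eval_X, Pi.single_apply]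
    rcases eq_or_ne i j with rfl | h
    · simp
    · simp [h]

end MvPolynomial

section Coadjoint

variable {ι L : Type*} [Fintype ι] [DecidableEq ι] [LieRing L] [LieAlgebra ℝ L]

/-- A vector of `L`, as a linear form on the dual, evaluated at the point with coordinates `x`. -/
noncomputable def Module.Basis.linearForm (b : Module.Basis ι ℝ L) (x : ι → ℝ) : L →ₗ[ℝ] ℝ :=
  b.constr ℝ x

/-- The sum $\sum_k C_{ij}^kx_k$ is the value at $x$ of $[X_i,X_j]$, which frees the operator from
structure constants. -/
theorem coadjointOp_eq_linearForm (b : Module.Basis ι ℝ L) (i : ι) (F : (ι → ℝ) → ℝ)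
    (x : ι → ℝ) :
    coadjointOp b i F x = -∑ j, b.linearForm x ⁅b i, b j⁆ * fderiv ℝ F x (Pi.single j 1) := by
  simp [coadjointOp, Module.Basis.linearForm, Module.Basis.constr_apply_fintype, Finset.sum_mul]

/-- On polynomials, `X̂_i` is minus the derivation that extends `ad X_i`. -/
theorem coadjointOp_eval (b : Module.Basis ι ℝ L) (i : ι) (P : MvPolynomial ι ℝ) (x : ι → ℝ) :
    coadjointOp b i (fun y => MvPolynomial.eval y P) x = -MvPolynomial.eval x
      (MvPolynomial.mkDerivation ℝ (fun j => b.constr ℝ MvPolynomial.X ⁅b i, b j⁆) P) := by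
  -- A derivation is fixed by its values on the variables, so this one is
  -- $\sum_j[X_i,X_j]\,\partial_j$.
  have h : MvPolynomial.mkDerivation ℝ (fun j => b.constr ℝ MvPolynomial.X ⁅b i, b j⁆) =
      ∑ j, b.constr ℝ (MvPolynomial.X (R := ℝ)) ⁅b i, b j⁆ • MvPolynomial.pderiv j := by
    refine MvPolynomial.derivation_ext fun k => ?_
    rw [MvPolynomial.mkDerivation_X, ← Derivation.coeFnAddMonoidHom_apply, map_sum,
      Finset.sum_apply, Finset.sum_eq_single k]
    · simp
    · intro j _ hj
      simp [MvPolynomial.pderiv_X_of_ne hj.symm]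
    · simp
  have h' : ∀ v, MvPolynomial.eval x (b.constr ℝ (MvPolynomial.X (R := ℝ)) v) =
      b.linearForm x v := fun v => by
    simp [Module.Basis.linearForm, Module.Basis.constr_apply_fintype]
  rw [coadjointOp_eq_linearForm, h, ← Derivation.coeFnAddMonoidHom_apply, map_sum,
    Finset.sum_apply, map_sum]
  simp only [MvPolynomial.fderiv_eval, Derivation.coeFnAddMonoidHom_apply, Derivation.smul_apply,
    smul_eq_mul, map_mul, h']

end Coadjoint

namespace QAlg

variable {n : ℕ}

/-! ### The invariants of `Q_{2n}` -/

theorem constr_gen {A : Type*} [AddCommGroup A] [Module ℝ A] (f : Fin (2 * n) → A) (k : ℕ) :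
    (basis n).constr ℝ f (gen n k) = oneBased f k := by
  unfold gen oneBased
  split_ifs
  · rw [Module.Basis.constr_basis]
  · rw [map_zero]

theorem linearForm_genBracket (x : Fin (2 * n) → ℝ) {i m : ℕ} (hi : 1 ≤ i) (hi' : i ≤ 2 * n)
    (hm : 1 ≤ m) (hm' : m ≤ 2 * n) :
    (basis n).linearForm x ⁅gen n i, gen n m⁆ = genBracket n (oneBased x) i m := by
  rw [lie_gen hi hi' hm hm', map_genBracket]
  simp only [Module.Basis.linearForm, constr_gen]

theorem mkDerivation_var (i : Fin (2 * n)) {m : ℕ} (hm : 1 ≤ m) (hm' : m ≤ 2 * n) :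
    MvPolynomial.mkDerivation ℝ
      (fun j => (basis n).constr ℝ (MvPolynomial.X (R := ℝ)) ⁅basis n i, basis n j⁆) (var n m) =
      genBracket n (var n) (i + 1) m := by
  rw [var_eq_X hm hm', MvPolynomial.mkDerivation_X, ← gen_eq_basis hm hm', basis_eq_gen,
    lie_gen (by omega) (by omega) hm hm', map_genBracket]
  simp only [constr_gen]
  rfl

theorem isInvariantOn_I₁ (U : Set (Fin (2 * n) → ℝ)) :
    IsInvariantOn (basis n) U fun x => MvPolynomial.eval x (I₁ n) := by
  refine ⟨(MvPolynomial.contDiff_eval _).contDiffOn, fun i x _ => ?_⟩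
  have hi := i.2
  rw [coadjointOp_eval, I₁, mkDerivation_var i (by omega) le_rfl, genBracket]
  split_ifs <;> first | omega | simp

theorem isInvariantOn_I₂ (hn : 3 ≤ n) (U : Set (Fin (2 * n) → ℝ)) :
    IsInvariantOn (basis n) U fun x => MvPolynomial.eval x (I₂ n) := by
  refine ⟨(MvPolynomial.contDiff_eval _).contDiffOn, fun i x _ => ?_⟩
  have h := map_quadratic (i := (i : ℕ) + 1) (g := var n)
    (D := (MvPolynomial.mkDerivation ℝ
      (fun j => (basis n).constr ℝ (MvPolynomial.X (R := ℝ)) ⁅basis n i, basis n j⁆)).toLinearMap)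
    hn (by omega) (by omega)
    (fun a b => (Derivation.leibniz _ a b).trans (by
      rw [smul_eq_mul, smul_eq_mul, add_comm, mul_comm b]
      rfl))
    (fun m hm hm' => mkDerivation_var i hm hm')
    (fun _ _ _ => Commute.all _ _) (fun _ _ _ => Commute.all _ _)
  -- By definition `I₂ n` is `quadratic n (var n)`.
  have h' : MvPolynomial.mkDerivation ℝ
      (fun j => (basis n).constr ℝ (MvPolynomial.X (R := ℝ)) ⁅basis n i, basis n j⁆) (I₂ n) = 0 := h
  rw [coadjointOp_eval, h', map_zero, neg_zero]

theorem pderiv_var (j : Fin (2 * n)) (k : ℕ) :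
    MvPolynomial.pderiv j (var n k) = if (j : ℕ) + 1 = k then 1 else 0 := by
  by_cases hk : 1 ≤ k ∧ k ≤ 2 * n
  · rw [var_eq_X hk.1 hk.2, MvPolynomial.pderiv_X, Pi.single_apply]
    have : (⟨k - 1, by omega⟩ : Fin (2 * n)) = j ↔ (j : ℕ) + 1 = k := by
      rw [Fin.ext_iff]; simp only; omega
    simp only [this]
  · rw [if_neg (by omega)]
    simp [var, oneBased, hk]

theorem pderiv_zero_I₂ (hn : 3 ≤ n) (j : Fin (2 * n)) (hj : (j : ℕ) = 0) :
    MvPolynomial.pderiv j (I₂ n) = var n (2 * n) := by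
  have h : ∀ k, k ≠ 1 → MvPolynomial.pderiv j (var n k) = 0 := fun k hk => by
    rw [pderiv_var, if_neg (by omega)]
  have h1 : MvPolynomial.pderiv j (var n 1) = 1 := by rw [pderiv_var, if_pos (by omega)]
  have hs : ∑ k ∈ Finset.Icc 4 n, MvPolynomial.pderiv j
      ((-1 : ℝ) ^ (k + 1) • (var n k * var n (2 * n + 2 - k))) = 0 := by
    refine Finset.sum_eq_zero fun k hk => ?_
    simp only [Finset.mem_Icc] at hk
    simp [Derivation.leibniz, h k (by omega), h (2 * n + 2 - k) (by omega)]
  rw [I₂, map_add, map_add, map_add, map_sum, hs]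
  simp [Derivation.leibniz, h1, h (2 * n) (by omega), h 3 (by omega), h (2 * n - 1) (by omega),
    h (n + 1) (by omega), sq]

/-- In the direction $1$ the derivative of $I_1$ is $0$ and that of $I_2$ is $x_{2n}\ne0$, which
kills the coefficient of $dI_2$. The direction $2n$ then kills that of $dI_1$. -/
theorem linearIndependent_fderiv (hn : 3 ≤ n) (l : Fin (2 * n)) (hl : (l : ℕ) + 1 = 2 * n)
    {x : Fin (2 * n) → ℝ} (hx : x l ≠ 0) :
    LinearIndependent ℝ fun a => fderiv ℝ ((![fun x => MvPolynomial.eval x (I₁ n),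
      fun x => MvPolynomial.eval x (I₂ n)] : Fin 2 → (Fin (2 * n) → ℝ) → ℝ) a) x := by
  have he : (fun a => fderiv ℝ ((![fun x => MvPolynomial.eval x (I₁ n),
      fun x => MvPolynomial.eval x (I₂ n)] : Fin 2 → (Fin (2 * n) → ℝ) → ℝ) a) x) =
      ![fderiv ℝ (fun x => MvPolynomial.eval x (I₁ n)) x,
        fderiv ℝ (fun x => MvPolynomial.eval x (I₂ n)) x] := by
    funext a
    fin_cases a <;> rfl
  rw [he, LinearIndependent.pair_iff]
  intro s t h
  have key : ∀ j, s * MvPolynomial.eval x (MvPolynomial.pderiv j (I₁ n)) +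
      t * MvPolynomial.eval x (MvPolynomial.pderiv j (I₂ n)) = 0 := fun j => by
    have := DFunLike.congr_fun h (Pi.single j 1)
    simpa [MvPolynomial.fderiv_eval] using this
  have ht : t = 0 := by
    have h0 := key ⟨0, by omega⟩
    rw [pderiv_zero_I₂ hn _ rfl, I₁, pderiv_var, if_neg (by simp only; omega),
      var_eq_X (by omega) le_rfl, MvPolynomial.eval_X, map_zero, mul_zero, zero_add,
      show (⟨2 * n - 1, by omega⟩ : Fin (2 * n)) = l from Fin.ext (by simp only; omega)] at h0
    exact (mul_eq_zero.mp h0).resolve_right hx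
  refine ⟨?_, ht⟩
  have h1 := key l
  rw [ht, I₁, pderiv_var, if_pos hl] at h1
  simpa using h1

theorem dense_apply_ne_zero {ι : Type*} (l : ι) : Dense {x : ι → ℝ | x l ≠ 0} :=
  (dense_compl_singleton (0 : ℝ)).preimage (isOpenMap_eval l)

theorem isIndependentInvariantsOn (hn : 3 ≤ n) {U : Set (Fin (2 * n) → ℝ)} (hU : IsOpen U) :
    IsIndependentInvariantsOn (basis n) U
      ![fun x => MvPolynomial.eval x (I₁ n), fun x => MvPolynomial.eval x (I₂ n)] := by
  refine ⟨fun a => ?_, ?_⟩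
  · fin_cases a
    · exact isInvariantOn_I₁ U
    · exact isInvariantOn_I₂ hn U
  · let l : Fin (2 * n) := ⟨2 * n - 1, by omega⟩
    refine ((dense_apply_ne_zero l).open_subset_closure_inter hU).trans (closure_mono ?_)
    exact fun x hx => ⟨hx.1, linearIndependent_fderiv hn l
      (by simp only [l]; omega) hx.2⟩

/-! ### At most two independent invariants -/

/-- Where `x_{2n} ≠ 0`, a covector annihilated by all the `X̂_i` is determined by its first and last
components. -/
theorem eq_zero_of_coadjoint_eq_zero (hn : 3 ≤ n) {f l : Fin (2 * n)} (hf : (f : ℕ) = 0)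
    (hl : (l : ℕ) + 1 = 2 * n) {x : Fin (2 * n) → ℝ} (hx : x l ≠ 0) {φ : Fin (2 * n) → ℝ}
    (h : ∀ i, ∑ j, (basis n).linearForm x ⁅basis n i, basis n j⁆ * φ j = 0)
    (h0 : φ f = 0) (h1 : φ l = 0) : φ = 0 := by
  funext j
  by_cases hjf : j = f
  · rw [hjf, h0]; rfl
  by_cases hjl : j = l
  · rw [hjl, h1]; rfl
  have hj := j.2
  have hjf' : (j : ℕ) ≠ 0 := fun e => hjf (Fin.ext (by omega))
  have hjl' : (j : ℕ) + 1 ≠ 2 * n := fun e => hjl (Fin.ext (by omega))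
  -- Counted from $1$, the chosen index and that of $j$ add up to $2n+1$. This equation has
  -- coefficient $\pm x_{2n}$ at $j$, and its only other possible term is at the first component,
  -- where $\varphi$ vanishes.
  have hi := h ⟨2 * n - 1 - j, by omega⟩
  rw [Finset.sum_eq_single j] at hi
  · rw [basis_eq_gen, basis_eq_gen,
      linearForm_genBracket x (by omega) (by simp only; omega) (by omega) (by omega), genBracket,
      if_neg (by simp only; omega), if_neg (by omega), if_pos (by simp only; omega)] at hi
    have hxl : oneBased x (2 * n) = x l := by
      have : 1 ≤ 2 * n ∧ 2 * n ≤ 2 * n := by omega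
      rw [oneBased, dif_pos this]
      exact congrArg x (Fin.ext (by simp only; omega))
    rw [hxl, smul_eq_mul] at hi
    exact (mul_eq_zero.mp hi).resolve_left
      (mul_ne_zero (pow_ne_zero _ (by norm_num)) hx)
  · intro k _ hk
    by_cases hkf : k = f
    · rw [hkf, h0, mul_zero]
    · have hkf' : (k : ℕ) ≠ 0 := fun e => hkf (Fin.ext (by omega))
      have hk' : (k : ℕ) ≠ j := fun e => hk (Fin.ext e)
      rw [basis_eq_gen, basis_eq_gen,
        linearForm_genBracket x (by omega) (by simp only; omega) (by omega) (by omega), genBracket,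
        if_neg (by simp only; omega), if_neg (by omega), if_neg (by simp only; omega), zero_mul]
  · simp

/-- At a suitable point the differentials lie in the space $K$ of covectors annihilated by all
$\widehat X_i$, and taking the first and last components embeds $K$ in $\mathbb R^2$. -/
theorem card_le_two_of_independent (hn : 3 ≤ n) {U : Set (Fin (2 * n) → ℝ)} (hU : IsOpen U)
    (hne : U.Nonempty) {m : ℕ} {F : Fin m → (Fin (2 * n) → ℝ) → ℝ}
    (hF : IsIndependentInvariantsOn (basis n) U F) : m ≤ 2 := by
  let f : Fin (2 * n) := ⟨0, by omega⟩
  let l : Fin (2 * n) := ⟨2 * n - 1, by omega⟩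
  have hl : (l : ℕ) + 1 = 2 * n := by simp only [l]; omega
  have hVo : IsOpen (U ∩ {x : Fin (2 * n) → ℝ | x l ≠ 0}) :=
    hU.inter (isOpen_ne_fun (continuous_apply l) continuous_const)
  obtain ⟨y, hy⟩ := (dense_apply_ne_zero l).inter_open_nonempty U hU hne
  -- The points of independence are dense in $U$, so one of them lies in the nonempty open part
  -- where $x_{2n}\ne0$.
  obtain ⟨x, ⟨-, hx⟩, hxU, hLI⟩ := mem_closure_iff.mp (hF.2 hy.1) _ hVo hy
  let K : Submodule ℝ ((Fin (2 * n) → ℝ) →L[ℝ] ℝ) :=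
    { carrier := {φ | ∀ i, ∑ j, (basis n).linearForm x ⁅basis n i, basis n j⁆ *
        φ (Pi.single j 1) = 0}
      zero_mem' := fun i => by simp
      add_mem' := fun {φ ψ} hφ hψ i => by
        simp only [Set.mem_ofPred_eq] at hφ hψ
        simp only [add_apply, mul_add, Finset.sum_add_distrib, hφ i, hψ i, add_zero]
      smul_mem' := fun c φ hφ i => by
        simp only [Set.mem_ofPred_eq] at hφ
        simp only [smul_apply, smul_eq_mul, mul_left_comm _ c, ← Finset.mul_sum, hφ i, mul_zero] }
  let T : ((Fin (2 * n) → ℝ) →L[ℝ] ℝ) →ₗ[ℝ] ℝ × ℝ :=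
    { toFun := fun φ => (φ (Pi.single f 1), φ (Pi.single l 1))
      map_add' := fun _ _ => rfl
      map_smul' := fun _ _ => rfl }
  have hspan : Submodule.span ℝ (Set.range fun a => fderiv ℝ (F a) x) ≤ K := by
    rw [Submodule.span_le]
    rintro _ ⟨a, rfl⟩ i
    have := (hF.1 a).2 i x hxU
    rwa [coadjointOp_eq_linearForm, neg_eq_zero] at this
  have hdisj : Disjoint (Submodule.span ℝ (Set.range fun a => fderiv ℝ (F a) x))
      (LinearMap.ker T) := by
    refine Disjoint.mono_left hspan (Submodule.disjoint_def.mpr fun φ hφ hT => ?_)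
    have hT' : (φ (Pi.single f 1), φ (Pi.single l 1)) = ((0 : ℝ), (0 : ℝ)) := hT
    have h0 := eq_zero_of_coadjoint_eq_zero hn (f := f) rfl hl hx
      (φ := fun j => φ (Pi.single j 1)) hφ (congrArg Prod.fst hT') (congrArg Prod.snd hT')
    refine ContinuousLinearMap.coe_injective ((Pi.basisFun ℝ (Fin (2 * n))).ext fun j => ?_)
    rw [Pi.basisFun_apply]
    exact congrFun h0 j
  -- Injectivity of $T$ on the span keeps the $m$ images independent in $\mathbb R^2$.
  have := (hLI.map hdisj).fintype_card_le_finrank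
  simpa using this

end QAlg

theorem proposition2 (n : ℕ) (hn : 3 ≤ n) :
    -- on every nonempty open set the largest number of independent invariants is two,
    -- and the functions I₁, I₂ form a fundamental set of invariants
    (∀ U : Set (Fin (2 * n) → ℝ), IsOpen U → U.Nonempty →
      IsGreatest {m : ℕ | ∃ F : Fin m → (Fin (2 * n) → ℝ) → ℝ,
        IsIndependentInvariantsOn (QAlg.basis n) U F} 2 ∧
      IsFundamentalSetOn (QAlg.basis n) U
        ![fun x => MvPolynomial.eval x (QAlg.I₁ n), fun x => MvPolynomial.eval x (QAlg.I₂ n)]) ∧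
    -- the largest number of independent polynomial invariants is two
    IsGreatest {m : ℕ | ∃ P : Fin m → MvPolynomial (Fin (2 * n)) ℝ,
      IsIndependentInvariantsOn (QAlg.basis n) Set.univ
        (fun a x => MvPolynomial.eval x (P a))} 2 ∧
    -- the symmetrizations of I₁ and I₂ are Casimir operators
    symmetrization (QAlg.basis n) (QAlg.I₁ n) ∈
      Subalgebra.center ℝ (UniversalEnvelopingAlgebra ℝ (QAlg n)) ∧
    symmetrization (QAlg.basis n) (QAlg.I₂ n) ∈
      Subalgebra.center ℝ (UniversalEnvelopingAlgebra ℝ (QAlg n)) ∧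
    -- and they arise by replacing each variable by the corresponding generator
    symmetrization (QAlg.basis n) (QAlg.I₁ n) = QAlg.genU n (2 * n) ∧
    symmetrization (QAlg.basis n) (QAlg.I₂ n) =
      QAlg.genU n 1 * QAlg.genU n (2 * n) + QAlg.genU n 3 * QAlg.genU n (2 * n - 1) +
        (∑ k ∈ Finset.Icc 4 n,
          (-1 : ℝ) ^ (k + 1) • (QAlg.genU n k * QAlg.genU n (2 * n + 2 - k))) +
        ((-1 : ℝ) ^ n / 2) • QAlg.genU n (n + 1) ^ 2 := by
  have hI₁ : symmetrization (QAlg.basis n) (QAlg.I₁ n) = QAlg.genU n (2 * n) :=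
    QAlg.symmetrization_var (by omega) le_rfl
  have hI₂ := QAlg.symmetrization_I₂ hn
  refine ⟨fun U hU hne => ⟨⟨⟨_, QAlg.isIndependentInvariantsOn hn hU⟩, ?_⟩,
    QAlg.isIndependentInvariantsOn hn hU, fun G hG hind => ?_⟩, ⟨⟨![QAlg.I₁ n, QAlg.I₂ n], ?_⟩, ?_⟩,
    ?_, ?_, hI₁, hI₂⟩
  · rintro m ⟨F, hF⟩
    exact QAlg.card_le_two_of_independent hn hU hne hF
  -- An enlarged family would consist of three independent invariants.
  · have h3 := QAlg.card_le_two_of_independent hn hU hne ⟨fun a => ?_, hind⟩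
    · omega
    · refine Fin.lastCases ?_ (fun a => ?_) a
      · rwa [Fin.snoc_last]
      · rw [Fin.snoc_castSucc]
        exact (QAlg.isIndependentInvariantsOn hn hU).1 a
  · convert QAlg.isIndependentInvariantsOn hn isOpen_univ using 1
    funext a
    fin_cases a <;> rfl
  · rintro m ⟨P, hP⟩
    exact QAlg.card_le_two_of_independent hn isOpen_univ Set.univ_nonempty hP
  · rw [hI₁]
    exact QAlg.genU_last_mem_center
  · rw [hI₂]
    exact QAlg.quadratic_genU_mem_center hn
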